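/- Let $K$ be a field of characteristic $0$ (for instance $\mathbb{C}$), let $1\le k\le n-1$, and let $K[\mathrm{Gr}(k,n)]$ be the homogeneous coordinate ring of the Grassmannian, i.e. the algebra generated by the Plücker coordinates $P_I$ ($I$ a $k$-subset of $\{1,\dots,n\}$), which are the maximal minors of a generic $k\times n$ matrix $X$. It is graded by $\deg P_I=1$, and $g\in \mathrm{GL}_n(K)$ acts by $(g\cdot f)(X)=f(Xg)$, so that $t=\mathrm{diag}(t_1,\dots,t_n)$ acts by $t\cdot P_I=\bigl(\prod_{i\in I}t_i\bigr)P_I$. The grading and the torus action extend to the field of fractions $F$ of $K[\mathrm{Gr}(k,n)]$: a fraction $a/b$ with $a,b$ homogeneous has degree $\deg a-\deg b$. A nonzero $f\in F$ is an eigenfunction of multidegree $\mathbf d(f)\in\mathbb{Z}^n$ if $t\cdot f=\prod_i t_i^{\mathbf d(f)_i}\,f$ for all diagonal $t$. A seed is a pair $(Q,\underline{x})$ of a finite quiver $Q$ without loops and 2-cycles, some of whose vertices are frozen, and a family $\underline{x}=(x_i)_{i\in Q_0}$ in $F$. Mutation at a mutable vertex $m$ replaces $x_m$ by $x_m'$ with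 $x_m'x_m=\prod_{i\to m}x_i+\prod_{m\to j}x_j$, and changes $Q$ by adding an arrow $i\to j$ for each path $i\to m\to j$, reversing all arrows at $m$, and cancelling 2-cycles. The cluster structure is given by the following initial seed of Plücker coordinates. For integers $0\le i\le k$, $0\le g\le n-k$ put $a=-\lfloor (i+g)/2\rfloor$ and, modulo $n$, $$L(i,g)=\{a+1,\dots,a+i\}\cup\{a+i+g+1,\dots,a+g+k\}.$$ The mutable vertices are the $(i,g)$ with $0<i<k$ and $0<g<n-k$, and $(i,g)$ carries $P_{L(i,g)}$. The frozen vertices carry the $n$ Plücker coordinates of the cyclic intervals $\{j+1,\dots,j+k\}$ (modulo $n$). For $i\in\{0,k\}$ or $g\in\{0,n-k\}$ the set $L(i,g)$ is a cyclic interval, and the point $(i,g)$ stands for the corresponding frozen vertex. If $i+g$ is even, the mutable vertex $(i,g)$ has arrows from $(i\pm1,g)$ and arrows to $(i,g\pm1)$; if $i+g$ is odd, it has arrows to $(i\pm1,g)$ and arrows from $(i,g\pm1)$; there are no other arrows. The seeds of $K[\mathrm{Gr}(k,n)]$ are those obtained from the initial one by finitely many mutations, and the cluster variables (with the frozen variables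 included) are the elements of the seeds. Then: 1. Every cluster variable $z\in F$ is nonzero, homogeneous, and an eigenfunction for the diagonal torus of $\mathrm{GL}_n(K)$, with a multidegree whose coordinates sum to $k\deg z$. If $z\in K[\mathrm{Gr}(k,n)]$ (by a theorem of Scott this is always so, but it is not part of the claim), then $z$ lies in a single graded component of $K[\mathrm{Gr}(k,n)]$ and is an eigenfunction for the diagonal torus there. 2. In every seed $(Q,\underline{x})$ of $K[\mathrm{Gr}(k,n)]$ each $x_i$ has a unique multidegree $\mathbf d(x_i)\in\mathbb{Z}^n$, and the multidegrees are balanced: for every mutable vertex $m$ of $Q$, $$\sum_{i\to m}\mathbf d(x_i)=\sum_{m\to j}\mathbf d(x_j),$$ where the sums run over arrows. -/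

import Mathlib

noncomputable section

namespace GrCluster

/-! ### The homogeneous coordinate ring of the Grassmannian -/

section CoordinateRing

variable (K : Type*) [Field K] (k n : ℕ)

/-- The `k`-subsets of the set of columns. The columns `1, …, n` are numbered `0, …, n - 1`. -/
abbrev KSubset : Type := {I : Finset (Fin n) // I.card = k}

/-- The generic `k × n` matrix, whose entries are independent variables. -/
def genericMatrix : Matrix (Fin k) (Fin n) (MvPolynomial (Fin k × Fin n) K) :=
  Matrix.of fun i j => MvPolynomial.X (i, j)

variable {k n}

/-- The maximal minor of the generic matrix on the columns in `I`, taken in increasing order. -/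
def minor (I : KSubset k n) : MvPolynomial (Fin k × Fin n) K :=
  ((genericMatrix K k n).submatrix id (I.1.orderEmbOfFin I.2)).det

variable (k n)

/-- The homogeneous coordinate ring `K[Gr(k,n)]` of the Grassmannian in its Plücker embedding:
the algebra generated by the maximal minors of the generic `k × n` matrix, that is, the polynomial
ring in the Plücker coordinates modulo all polynomials that vanish on the maximal minors of
matrices. -/
def coordRing : Subalgebra K (MvPolynomial (Fin k × Fin n) K) :=
  Algebra.adjoin K (Set.range (minor K (k := k) (n := n)))

variable {k n}

/-- The Plücker coordinate of a `k`-subset. -/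
def plucker (I : KSubset k n) : coordRing K k n :=
  ⟨minor K I, Algebra.subset_adjoin ⟨I, rfl⟩⟩

variable (k n)

/-- The component of degree `d` of the coordinate ring: the values at the Plücker coordinates of
the homogeneous polynomials of degree `d`. -/
def homogeneousPart (d : ℕ) : Submodule K (coordRing K k n) :=
  (MvPolynomial.homogeneousSubmodule (KSubset k n) K d).map
    (MvPolynomial.aeval (plucker K (k := k) (n := n))).toLinearMap

/-- The field of fractions of the coordinate ring, the ambient field of the cluster algebra. -/
abbrev FunctionField : Type _ := FractionRing (coordRing K k n)

variable {K k n}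

/-- A fraction is homogeneous of degree `e` if it is a quotient of two homogeneous elements of the
coordinate ring, whose degrees differ by `e`. -/
def IsHomogeneousOfDegree (e : ℤ) (z : FunctionField K k n) : Prop :=
  ∃ (p q : ℕ) (a b : coordRing K k n), a ∈ homogeneousPart K k n p ∧ b ∈ homogeneousPart K k n q ∧
    b ≠ 0 ∧ (p : ℤ) - (q : ℤ) = e ∧
    z = algebraMap (coordRing K k n) (FunctionField K k n) a /
      algebraMap (coordRing K k n) (FunctionField K k n) b

end CoordinateRing

/-! ### The diagonal torus -/

section Torus

variable {K : Type*} [Field K] {k n : ℕ}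

/-- The action of the diagonal matrix `t` on polynomials in the matrix entries. An element `g` of
`GL_n` acts by `(g • f) X = f (X * g)`, so `t` multiplies the variables of column `j` by `t j`. -/
def torusPoly (t : Fin n → Kˣ) :
    MvPolynomial (Fin k × Fin n) K →ₐ[K] MvPolynomial (Fin k × Fin n) K :=
  MvPolynomial.aeval fun p => MvPolynomial.C (t p.2 : K) * MvPolynomial.X p

theorem torusPoly_minor (t : Fin n → Kˣ) (I : KSubset k n) :
    torusPoly t (minor K I) = MvPolynomial.C (((∏ j ∈ I.1, t j : Kˣ) : K)) * minor K I := by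
  have h1 : torusPoly t (minor K I) = (Matrix.of fun i j : Fin k =>
      MvPolynomial.C (t (I.1.orderEmbOfFin I.2 j) : K) *
        (genericMatrix K k n).submatrix id (I.1.orderEmbOfFin I.2) i j).det := by
    rw [minor, AlgHom.map_det]
    congr 1
    ext1 i j
    simp [torusPoly, genericMatrix]
  rw [h1, Matrix.det_mul_row, minor]
  congr 1
  have h2 : ∏ j ∈ I.1, t j = ∏ i, t (I.1.orderEmbOfFin I.2 i) := by
    conv_lhs => rw [← Finset.map_orderEmbOfFin_univ I.1 I.2]
    rw [Finset.prod_map]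
    rfl
  rw [h2]
  simp

theorem torusPoly_mem (t : Fin n → Kˣ) (f : coordRing K k n) :
    torusPoly t f.1 ∈ coordRing K k n := by
  have h : coordRing K k n ≤ (coordRing K k n).comap (torusPoly t) := by
    refine Algebra.adjoin_le ?_
    rintro _ ⟨I, rfl⟩
    change torusPoly t (minor K I) ∈ coordRing K k n
    rw [torusPoly_minor]
    exact mul_mem ((coordRing K k n).algebraMap_mem _) (plucker K I).2
  exact h f.2

theorem torusPoly_inv (t s : Fin n → Kˣ) (h : ∀ j, t j * s j = 1)
    (f : MvPolynomial (Fin k × Fin n) K) : torusPoly t (torusPoly s f) = f := by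
  have h2 : (torusPoly t).comp (torusPoly s) = AlgHom.id K (MvPolynomial (Fin k × Fin n) K) := by
    apply MvPolynomial.algHom_ext
    intro p
    have h3 : (s p.2 : K) * (t p.2 : K) = 1 := by
      rw [mul_comm, ← Units.val_mul, h p.2, Units.val_one]
    simp [torusPoly, MvPolynomial.algHom_C, ← mul_assoc, ← MvPolynomial.C_mul, h3]
  exact DFunLike.congr_fun h2 f

variable (k) in
/-- The action of the diagonal torus of `GL_n` on the coordinate ring. -/
def torusAct (t : Fin n → Kˣ) : coordRing K k n ≃ₐ[K] coordRing K k n :=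
  AlgEquiv.ofAlgHom
    (((torusPoly t).comp (coordRing K k n).val).codRestrict _ (torusPoly_mem t))
    (((torusPoly t⁻¹).comp (coordRing K k n).val).codRestrict _ (torusPoly_mem t⁻¹))
    (AlgHom.ext fun f => Subtype.ext (torusPoly_inv t t⁻¹ (fun j => by simp) f.1))
    (AlgHom.ext fun f => Subtype.ext (torusPoly_inv t⁻¹ t (fun j => by simp) f.1))

/-- The automorphism of the field of fractions that is induced by an automorphism of a domain. -/
def fracEquiv {A : Type*} [CommRing A] [IsDomain A] [Algebra K A] (φ : A ≃ₐ[K] A) :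
    FractionRing A ≃ₐ[K] FractionRing A :=
  IsFractionRing.fieldEquivOfAlgEquiv K (FractionRing A) (FractionRing A) φ

variable (k) in
/-- The induced action of the diagonal torus on the field of fractions. -/
def torusActFrac (t : Fin n → Kˣ) : FunctionField K k n ≃ₐ[K] FunctionField K k n :=
  fracEquiv (torusAct k t)

/-- The value of the character `w` at the diagonal matrix `t`. -/
def character (w : Fin n → ℤ) (t : Fin n → Kˣ) : K :=
  ((∏ j, t j ^ w j : Kˣ) : K)

/-- `z` satisfies the eigenvalue equation of the diagonal torus with weight `w`; for nonzero `z`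
this says that `z` is an eigenfunction of multidegree `w`. -/
def HasMultidegree (w : Fin n → ℤ) (z : FunctionField K k n) : Prop :=
  ∀ t : Fin n → Kˣ, torusActFrac k t z = character w t • z

end Torus

/-! ### Seeds and mutation -/

section Seeds

/-- Seeds (ice quivers together with a family of elements of the field `F`) with mutable vertices
`M` and frozen vertices `N`. There are `arr u v` arrows from `u` to `v`. -/
structure Seed (M N F : Type*) where
  arr : M ⊕ N → M ⊕ N → ℕ
  var : M ⊕ N → F

variable {M N F : Type*} [Fintype M] [Fintype N] [DecidableEq M] [DecidableEq N] [Field F]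

/-- Quiver mutation at `m`: add an arrow `i → j` for every path `i → m → j`, reverse all arrows at
`m`, and cancel 2-cycles (the truncated subtraction of natural numbers is intended). -/
def mutateArr (arr : M ⊕ N → M ⊕ N → ℕ) (m : M ⊕ N) : M ⊕ N → M ⊕ N → ℕ := fun i j =>
  if i = m ∨ j = m then arr j i
  else (arr i j + arr i m * arr m j) - (arr j i + arr j m * arr m i)

/-- Seed mutation at a mutable vertex `m`: the variable `x` at `m` is replaced by the solution `x'`
of the exchange relation `x' * x = ∏_{i → m} x_i + ∏_{m → j} x_j`. -/
def Seed.mutate (S : Seed M N F) (m : M) : Seed M N F where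
  arr := mutateArr S.arr (Sum.inl m)
  var := Function.update S.var (Sum.inl m)
    ((∏ v, S.var v ^ S.arr v (Sum.inl m) + ∏ v, S.var v ^ S.arr (Sum.inl m) v) /
      S.var (Sum.inl m))

/-- `S'` is obtained from `S` by a finite sequence of mutations. -/
inductive Seed.MutatesTo (S : Seed M N F) : Seed M N F → Prop
  | refl : Seed.MutatesTo S S
  | step (S' : Seed M N F) (m : M) : Seed.MutatesTo S S' → Seed.MutatesTo S (S'.mutate m)

end Seeds

/-! ### The initial seed of the Grassmannian cluster algebra

The mutable vertices are the points `(i, g)` of a grid, `0 < i < k` and `0 < g < n - k`. At `(i, g)`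
stands the Plücker coordinate of the union of two cyclic intervals, of `i` and of `k - i` elements,
the second starting `g` places after the end of the first. For `i = 0`, `i = k`, `g = 0` or
`g = n - k` such a union is a single cyclic interval, so the points on the boundary of the grid stand
for frozen vertices. Each mutable vertex has four neighbours, two horizontal and two vertical ones,
and each initial exchange relation is a short Plücker relation. -/

section InitialSeed

variable (k n : ℕ)

/-- The cyclic interval `s, s + 1, …, s + l - 1` modulo `n`. -/
def cycInterval (s : ℤ) (l : ℕ) : Finset (Fin n) :=
  Finset.univ.filter fun c => ((c : ℤ) - s) % (n : ℤ) < (l : ℤ)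

theorem card_cycInterval (s : ℤ) (l : ℕ) (hl : l ≤ n) : (cycInterval n s l).card = l := by
  rcases Nat.eq_zero_or_pos n with rfl | hn
  · obtain rfl : l = 0 := by omega
    rfl
  have hn' : (0 : ℤ) < n := by exact_mod_cast hn
  have key : (cycInterval n s l).card = (Finset.range l).card := by
    refine Finset.card_bij' (fun c _ => (((c : ℤ) - s) % (n : ℤ)).toNat)
      (fun i _ => ⟨((s + (i : ℤ)) % (n : ℤ)).toNat, by
        have h1 := Int.emod_nonneg (s + (i : ℤ)) hn'.ne'
        have h2 := Int.emod_lt_of_pos (s + (i : ℤ)) hn'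
        omega⟩) ?_ ?_ ?_ ?_
    · intro c hc
      have h0 : ((c : ℤ) - s) % (n : ℤ) < (l : ℤ) := by simpa [cycInterval] using hc
      have h1 := Int.emod_nonneg ((c : ℤ) - s) hn'.ne'
      rw [Finset.mem_range]
      omega
    · intro i hi
      rw [Finset.mem_range] at hi
      have h1 := Int.emod_nonneg (s + (i : ℤ)) hn'.ne'
      simp only [cycInterval, Finset.mem_filter, Finset.mem_univ, true_and, Int.toNat_of_nonneg h1,
        Int.emod_sub_emod, add_sub_cancel_left]
      rw [Int.emod_eq_of_lt] <;> omega
    · intro c hc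
      have h1 := Int.emod_nonneg ((c : ℤ) - s) hn'.ne'
      ext
      simp only [Int.toNat_of_nonneg h1, Int.add_emod_emod, add_sub_cancel]
      rw [Int.emod_eq_of_lt] <;> omega
    · intro i hi
      rw [Finset.mem_range] at hi
      have h1 := Int.emod_nonneg (s + (i : ℤ)) hn'.ne'
      simp only [Int.toNat_of_nonneg h1, Int.emod_sub_emod, add_sub_cancel_left]
      rw [Int.emod_eq_of_lt] <;> omega
  simpa using key

theorem disjoint_cycInterval (s : ℤ) (i g l : ℕ) (h : i + g + l ≤ n) :
    Disjoint (cycInterval n s i) (cycInterval n (s + i + g) l) := by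
  rw [Finset.disjoint_left]
  intro c hc hc'
  have hn' : (0 : ℤ) < n := by have := c.2; omega
  have h0 : ((c : ℤ) - s) % (n : ℤ) < (i : ℤ) := by simpa [cycInterval] using hc
  have h1 : ((c : ℤ) - (s + i + g)) % (n : ℤ) < (l : ℤ) := by simpa [cycInterval] using hc'
  have h2 := Int.emod_nonneg ((c : ℤ) - s) hn'.ne'
  have h3 : ((c : ℤ) - (s + i + g)) % (n : ℤ) = ((c : ℤ) - s) % (n : ℤ) - (i + g) + n := by
    have e : ((c : ℤ) - s) % (n : ℤ) - (i + g) + n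
        = ((c : ℤ) - (s + i + g)) + n * (1 - ((c : ℤ) - s) / (n : ℤ)) := by
      have := Int.emod_add_mul_ediv ((c : ℤ) - s) n
      linarith
    have e2 : (((c : ℤ) - s) % (n : ℤ) - (i + g) + n) % n
        = ((c : ℤ) - s) % (n : ℤ) - (i + g) + n := by
      rw [Int.emod_eq_of_lt] <;> omega
    rw [← e2, e, Int.add_mul_emod_self_left]
  omega

/-- Mutable vertices: `(a, b)` is the grid point `(a + 1, b + 1)`. -/
abbrev MutableVertex : Type := Fin (k - 1) × Fin (n - k - 1)

/-- All vertices of the quivers: the mutable ones, and `n` frozen ones. -/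
abbrev Vertex : Type := MutableVertex k n ⊕ Fin n

variable {k n}

/-- The grid point of a mutable vertex. -/
def gridPoint (u : MutableVertex k n) : ℕ × ℕ := (u.1.val + 1, u.2.val + 1)

/-- The first element of the first interval at the grid point `(i, g)`. -/
def offset (p : ℕ × ℕ) : ℤ := -(((p.1 + p.2) / 2 : ℕ) : ℤ)

/-- The `k`-subset of a vertex: two cyclic intervals for a mutable vertex, and the cyclic interval
`j, …, j + k - 1` for the frozen vertex `j`. -/
def label (hkn : k < n) : Vertex k n → KSubset k n
  | .inl u =>
    ⟨cycInterval n (offset (gridPoint u)) (gridPoint u).1 ∪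
      cycInterval n (offset (gridPoint u) + ((gridPoint u).1 : ℤ) + ((gridPoint u).2 : ℤ))
        (k - (gridPoint u).1), by
      have h1 := u.1.isLt
      have h2 := u.2.isLt
      have e1 : (gridPoint u).1 = u.1.val + 1 := rfl
      have e2 : (gridPoint u).2 = u.2.val + 1 := rfl
      rw [Finset.card_union_of_disjoint (disjoint_cycInterval n _ _ _ _ (by omega)),
        card_cycInterval n _ _ (by omega), card_cycInterval n _ _ (by omega)]
      omega⟩
  | .inr j => ⟨cycInterval n (j.val : ℤ) k, card_cycInterval n _ _ hkn.le⟩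

/-- The vertex of a grid point `(i, g)` with `0 ≤ i ≤ k` and `0 ≤ g ≤ n - k`. A point on the boundary
gives the frozen vertex of its cyclic interval; this starts with the second of the two intervals
if `i = 0` or `g = n - k`, and with the first one if `i = k` or `g = 0`. -/
def vertexAt (hkn : k < n) (p : ℕ × ℕ) : Vertex k n :=
  if h : (0 < p.1 ∧ p.1 < k) ∧ (0 < p.2 ∧ p.2 < n - k) then
    .inl (⟨p.1 - 1, by omega⟩, ⟨p.2 - 1, by omega⟩)
  else .inr ⟨((if p.1 = 0 ∨ p.2 = n - k then offset p + (p.1 : ℤ) + (p.2 : ℤ) else offset p)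
      % (n : ℤ)).toNat, by
    have hn : (0 : ℤ) < n := by omega
    have h1 := Int.emod_lt_of_pos
      (if p.1 = 0 ∨ p.2 = n - k then offset p + (p.1 : ℤ) + (p.2 : ℤ) else offset p) hn
    omega⟩

/-- The vertices at the neighbours of a grid point in the direction of `i`. -/
def verticalNbrs (hkn : k < n) (p : ℕ × ℕ) : Multiset (Vertex k n) :=
  {vertexAt hkn (p.1 + 1, p.2), vertexAt hkn (p.1 - 1, p.2)}

/-- The vertices at the neighbours of a grid point in the direction of `g`. -/
def horizontalNbrs (hkn : k < n) (p : ℕ × ℕ) : Multiset (Vertex k n) :=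
  {vertexAt hkn (p.1, p.2 + 1), vertexAt hkn (p.1, p.2 - 1)}

/-- The vertices to which arrows go from a mutable vertex: the horizontal neighbours where `i + g`
is even, the vertical ones where it is odd. -/
def outNbrs (hkn : k < n) (u : MutableVertex k n) : Multiset (Vertex k n) :=
  if Even ((gridPoint u).1 + (gridPoint u).2) then horizontalNbrs hkn (gridPoint u)
  else verticalNbrs hkn (gridPoint u)

/-- The vertices from which arrows go to a mutable vertex. -/
def inNbrs (hkn : k < n) (u : MutableVertex k n) : Multiset (Vertex k n) :=
  if Even ((gridPoint u).1 + (gridPoint u).2) then verticalNbrs hkn (gridPoint u)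
  else horizontalNbrs hkn (gridPoint u)

/-- The arrows of the initial quiver; none are drawn between frozen vertices. -/
def initialArr (hkn : k < n) : Vertex k n → Vertex k n → ℕ
  | .inl u, v => (outNbrs hkn u).count v
  | .inr j, .inl u => (inNbrs hkn u).count (.inr j)
  | .inr _, .inr _ => 0

variable (K : Type*) [Field K]

/-- The initial seed of the cluster algebra `K[Gr(k,n)]`. -/
def initialSeed (hkn : k < n) :
    Seed (MutableVertex k n) (Fin n) (FunctionField K k n) where
  arr := initialArr hkn
  var v := algebraMap (coordRing K k n) (FunctionField K k n) (plucker K (label hkn v))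

/-- The seeds of the cluster algebra `K[Gr(k,n)]`. -/
def seeds (hkn : k < n) : Set (Seed (MutableVertex k n) (Fin n) (FunctionField K k n)) :=
  {S | (initialSeed K hkn).MutatesTo S}

/-- The cluster variables of `K[Gr(k,n)]`, with the frozen variables among them: all elements of
all seeds. -/
def clusterVariables (hkn : k < n) : Set (FunctionField K k n) :=
  {z | ∃ S ∈ seeds K hkn, ∃ v, S.var v = z}

end InitialSeed

end GrCluster

end

/-! The proof is an induction on mutations, with the invariant `IsGradedSeed`: a loop-free quiver,
balanced multidegrees `w`, degrees `d` with `∑ j, w v j = k * d v`, and variables that are positive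
at a fixed matrix.

If the multidegrees balance at `m`, both monomials of the exchange relation have the same weight
`W`, so the new variable is an eigenfunction of weight `W - w m`. Balance survives the mutation by a
computation with signed arrow counts (`IsBalanced.mutate`). Summing coordinates and cancelling `k`
gives balance of the degrees, hence homogeneity. Division by a variable requires that it be nonzero:
exchange relations are subtraction-free, and all Plücker coordinates are positive rationals at a
Vandermonde matrix.

For the initial seed, balance is an identity between the indicator vectors at the four neighbours of
a grid point (`gridWeight_cross`). For an eigenfunction in the coordinate ring, the scalar matrix
`2` separates the graded components, because it acts on degree `d` by `2 ^ (k * d)`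
(`mem_homogeneousPart_of_hasMultidegree`). -/

namespace GrCluster

/-! ### Weights -/

section Weights

variable {K : Type*} [Field K] {k n : ℕ}

theorem character_add (w w' : Fin n → ℤ) (t : Fin n → Kˣ) :
    character (w + w') t = character w t * character w' t := by
  simp [character, zpow_add, Finset.prod_mul_distrib]

theorem character_sub (w w' : Fin n → ℤ) (t : Fin n → Kˣ) :
    character (w - w') t = character w t / character w' t := by
  simp [character, zpow_sub, Finset.prod_mul_distrib, div_eq_mul_inv]

theorem character_const (w : Fin n → ℤ) (c : Kˣ) :
    character w (fun _ => c) = ((c ^ ∑ j, w j : Kˣ) : K) := by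
  rw [character]
  congr 1
  induction (Finset.univ : Finset (Fin n)) using Finset.induction_on with
  | empty => simp
  | insert a s ha ih => rw [Finset.prod_insert ha, Finset.sum_insert ha, zpow_add, ih]

/-- `K` carries no order, so the comparison of powers takes place in the prime field `ℚ`. -/
theorem zpow_two_injective [CharZero K] {a b : ℤ} (h : (2 : K) ^ a = (2 : K) ^ b) : a = b := by
  have h' : ((2 ^ a : ℚ) : K) = ((2 ^ b : ℚ) : K) := by push_cast; exact h
  exact zpow_right_injective₀ (by norm_num) (by norm_num) (Rat.cast_injective h')

theorem character_injective [CharZero K] {w w' : Fin n → ℤ}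
    (h : ∀ t : Fin n → Kˣ, character w t = character w' t) : w = w' := by
  ext j
  -- The torus element with `2` in place `j` and `1` elsewhere isolates the `j`-th exponent; `2` has
  -- infinite order in characteristic zero.
  have h2 := h (Function.update 1 j (Units.mk0 2 two_ne_zero))
  have key (w : Fin n → ℤ) :
      character w (Function.update 1 j (Units.mk0 (2 : K) two_ne_zero)) = 2 ^ w j := by
    rw [character, Finset.prod_eq_single j]
    · simp
    · intro b _ hb
      simp [hb]
    · simp
  rw [key, key] at h2
  exact zpow_two_injective h2

theorem HasMultidegree.mul {w w' : Fin n → ℤ} {y z : FunctionField K k n}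
    (hy : HasMultidegree w y) (hz : HasMultidegree w' z) : HasMultidegree (w + w') (y * z) := by
  intro t
  rw [map_mul, hy t, hz t, character_add, smul_mul_smul_comm]

theorem HasMultidegree.one : HasMultidegree 0 (1 : FunctionField K k n) := by
  intro t
  simp [character]

theorem HasMultidegree.add {w : Fin n → ℤ} {y z : FunctionField K k n}
    (hy : HasMultidegree w y) (hz : HasMultidegree w z) : HasMultidegree w (y + z) := by
  intro t
  rw [map_add, hy t, hz t, smul_add]

theorem HasMultidegree.div {w w' : Fin n → ℤ} {y z : FunctionField K k n}
    (hy : HasMultidegree w y) (hz : HasMultidegree w' z) : HasMultidegree (w - w') (y / z) := by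
  intro t
  rw [map_div₀, hy t, hz t, character_sub]
  simp only [Algebra.smul_def, map_div₀]
  rw [mul_div_mul_comm]

theorem HasMultidegree.pow {w : Fin n → ℤ} {z : FunctionField K k n}
    (hz : HasMultidegree w z) (r : ℕ) : HasMultidegree (r • w) (z ^ r) := by
  induction r with
  | zero => simpa using HasMultidegree.one
  | succ r ih => simpa [pow_succ, add_mul, succ_nsmul] using ih.mul hz

theorem HasMultidegree.prod {ι : Type*} (s : Finset ι) {w : ι → Fin n → ℤ}
    {z : ι → FunctionField K k n} (h : ∀ i ∈ s, HasMultidegree (w i) (z i)) :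
    HasMultidegree (∑ i ∈ s, w i) (∏ i ∈ s, z i) := by
  classical
  induction s using Finset.induction_on with
  | empty => simpa using HasMultidegree.one
  | insert a s ha ih =>
    rw [Finset.sum_insert ha, Finset.prod_insert ha]
    exact (h a (by simp)).mul (ih fun i hi => h i (by simp [hi]))

theorem HasMultidegree.eq [CharZero K] {w w' : Fin n → ℤ} {z : FunctionField K k n} (hz : z ≠ 0)
    (h : HasMultidegree w z) (h' : HasMultidegree w' z) : w = w' :=
  character_injective fun t => smul_left_injective K hz ((h t).symm.trans (h' t))

theorem torusActFrac_algebraMap (t : Fin n → Kˣ) (f : coordRing K k n) :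
    torusActFrac k t (algebraMap _ _ f) =
      algebraMap (coordRing K k n) (FunctionField K k n) (torusAct k t f) := by
  simp [torusActFrac, fracEquiv]

theorem hasMultidegree_algebraMap_iff {w : Fin n → ℤ} {f : coordRing K k n} :
    HasMultidegree w (algebraMap (coordRing K k n) (FunctionField K k n) f) ↔
      ∀ t : Fin n → Kˣ, torusAct k t f = character w t • f := by
  have h (c : K) : c • algebraMap (coordRing K k n) (FunctionField K k n) f =
      algebraMap (coordRing K k n) (FunctionField K k n) (c • f) := by
    rw [Algebra.smul_def, Algebra.smul_def, map_mul, ← IsScalarTower.algebraMap_apply]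
  refine forall_congr' fun t => ?_
  rw [torusActFrac_algebraMap, h, (IsFractionRing.injective (coordRing K k n) _).eq_iff]

/-- The indicator vector of a set of columns. -/
def indicatorWeight (I : Finset (Fin n)) (j : Fin n) : ℤ := if j ∈ I then 1 else 0

theorem sum_indicatorWeight (I : Finset (Fin n)) : ∑ j, indicatorWeight I j = (I.card : ℤ) := by
  simp [indicatorWeight]

theorem torusAct_plucker (t : Fin n → Kˣ) (I : KSubset k n) :
    torusAct k t (plucker K I) = ((∏ j ∈ I.1, t j : Kˣ) : K) • plucker K I := by
  apply Subtype.ext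
  refine (torusPoly_minor t I).trans ?_
  rw [← MvPolynomial.smul_eq_C_mul]
  rfl

theorem character_indicatorWeight (I : Finset (Fin n)) (t : Fin n → Kˣ) :
    character (indicatorWeight I) t = ((∏ j ∈ I, t j : Kˣ) : K) := by
  rw [character]
  congr 1
  simp [indicatorWeight, Finset.prod_ite_mem]

theorem hasMultidegree_plucker (I : KSubset k n) :
    HasMultidegree (indicatorWeight I.1)
      (algebraMap (coordRing K k n) (FunctionField K k n) (plucker K I)) := by
  rw [hasMultidegree_algebraMap_iff]
  intro t
  rw [torusAct_plucker, character_indicatorWeight]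

end Weights

/-! ### Degrees -/

section Degrees

variable {K : Type*} [Field K] {k n : ℕ}

theorem mul_mem_homogeneousPart {p q : ℕ} {a b : coordRing K k n}
    (ha : a ∈ homogeneousPart K k n p) (hb : b ∈ homogeneousPart K k n q) :
    a * b ∈ homogeneousPart K k n (p + q) := by
  obtain ⟨f, hf, rfl⟩ := ha
  obtain ⟨g, hg, rfl⟩ := hb
  exact ⟨f * g, MvPolynomial.IsHomogeneous.mul hf hg, by simp⟩

theorem one_mem_homogeneousPart : (1 : coordRing K k n) ∈ homogeneousPart K k n 0 :=
  ⟨1, MvPolynomial.isHomogeneous_one _ _, by simp⟩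

theorem plucker_mem_homogeneousPart (I : KSubset k n) :
    plucker K I ∈ homogeneousPart K k n 1 :=
  ⟨MvPolynomial.X I, MvPolynomial.isHomogeneous_X _ _, by simp⟩

theorem isHomogeneousOfDegree_algebraMap {p : ℕ} {a : coordRing K k n}
    (ha : a ∈ homogeneousPart K k n p) :
    IsHomogeneousOfDegree p (algebraMap (coordRing K k n) (FunctionField K k n) a) :=
  ⟨p, 0, a, 1, ha, one_mem_homogeneousPart, one_ne_zero, by simp, by simp⟩

theorem IsHomogeneousOfDegree.one : IsHomogeneousOfDegree 0 (1 : FunctionField K k n) := by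
  simpa using isHomogeneousOfDegree_algebraMap (one_mem_homogeneousPart (K := K) (k := k) (n := n))

theorem algebraMap_ne_zero {b : coordRing K k n} (hb : b ≠ 0) :
    algebraMap (coordRing K k n) (FunctionField K k n) b ≠ 0 :=
  (map_ne_zero_iff _ (IsFractionRing.injective (coordRing K k n) _)).2 hb

theorem map_div_add_map_div {A F : Type*} [CommRing A] [Field F] (φ : A →+* F) {a b c d : A}
    (hb : φ b ≠ 0) (hd : φ d ≠ 0) : φ a / φ b + φ c / φ d = φ (a * d + b * c) / φ (b * d) := by
  rw [div_add_div _ _ hb hd, map_add, map_mul, map_mul, map_mul]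

theorem IsHomogeneousOfDegree.mul {d e : ℤ} {y z : FunctionField K k n}
    (hy : IsHomogeneousOfDegree d y) (hz : IsHomogeneousOfDegree e z) :
    IsHomogeneousOfDegree (d + e) (y * z) := by
  obtain ⟨p, q, a, b, ha, hb, hb0, hd, rfl⟩ := hy
  obtain ⟨p', q', a', b', ha', hb', hb0', he, rfl⟩ := hz
  refine ⟨p + p', q + q', a * a', b * b', mul_mem_homogeneousPart ha ha',
    mul_mem_homogeneousPart hb hb', mul_ne_zero hb0 hb0', by push_cast; omega, ?_⟩
  rw [map_mul, map_mul, div_mul_div_comm]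

theorem IsHomogeneousOfDegree.inv {d : ℤ} {z : FunctionField K k n} (hz0 : z ≠ 0)
    (hz : IsHomogeneousOfDegree d z) : IsHomogeneousOfDegree (-d) z⁻¹ := by
  obtain ⟨p, q, a, b, ha, hb, hb0, hd, rfl⟩ := hz
  refine ⟨q, p, b, a, hb, ha, ?_, by omega, by rw [inv_div]⟩
  rintro rfl
  simp at hz0

theorem IsHomogeneousOfDegree.div {d e : ℤ} {y z : FunctionField K k n} (hz0 : z ≠ 0)
    (hy : IsHomogeneousOfDegree d y) (hz : IsHomogeneousOfDegree e z) :
    IsHomogeneousOfDegree (d - e) (y / z) := by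
  rw [div_eq_mul_inv, sub_eq_add_neg]
  exact hy.mul (hz.inv hz0)

theorem IsHomogeneousOfDegree.add {d : ℤ} {y z : FunctionField K k n}
    (hy : IsHomogeneousOfDegree d y) (hz : IsHomogeneousOfDegree d z) :
    IsHomogeneousOfDegree d (y + z) := by
  obtain ⟨p, q, a, b, ha, hb, hb0, hd, rfl⟩ := hy
  obtain ⟨p', q', a', b', ha', hb', hb0', he, rfl⟩ := hz
  refine ⟨p + q', q + q', a * b' + b * a', b * b',
    add_mem (mul_mem_homogeneousPart ha hb') ?_,
    mul_mem_homogeneousPart hb hb', mul_ne_zero hb0 hb0', by push_cast; omega, ?_⟩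
  -- The two cross products are homogeneous of the same degree because the fractions have equal
  -- degree differences.
  · have h : p + q' = q + p' := by omega
    rw [h]
    exact mul_mem_homogeneousPart hb ha'
  · exact map_div_add_map_div _ (algebraMap_ne_zero hb0) (algebraMap_ne_zero hb0')

theorem IsHomogeneousOfDegree.pow {d : ℤ} {z : FunctionField K k n}
    (hz : IsHomogeneousOfDegree d z) (r : ℕ) : IsHomogeneousOfDegree (r • d) (z ^ r) := by
  induction r with
  | zero => simpa using IsHomogeneousOfDegree.one
  | succ r ih => rw [pow_succ, succ_nsmul]; exact ih.mul hz

theorem IsHomogeneousOfDegree.prod {ι : Type*} (s : Finset ι) {d : ι → ℤ}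
    {z : ι → FunctionField K k n} (h : ∀ i ∈ s, IsHomogeneousOfDegree (d i) (z i)) :
    IsHomogeneousOfDegree (∑ i ∈ s, d i) (∏ i ∈ s, z i) := by
  classical
  induction s using Finset.induction_on with
  | empty => simpa using IsHomogeneousOfDegree.one
  | insert a s ha ih =>
    rw [Finset.sum_insert ha, Finset.prod_insert ha]
    exact (h a (by simp)).mul (ih fun i hi => h i (by simp [hi]))

/-- A scalar matrix `c` multiplies every Plücker coordinate by `c ^ k`, hence every monomial of
degree `d` in them by `c ^ (k * d)`. -/
theorem torusAct_const_homogeneousPart (c : Kˣ) {d : ℕ} {a : coordRing K k n}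
    (ha : a ∈ homogeneousPart K k n d) :
    torusAct k (fun _ => c) a = ((c : K) ^ (k * d)) • a := by
  obtain ⟨f, hf, rfl⟩ := ha
  have h (I : KSubset k n) : torusAct k (fun _ => c) (plucker K I) = ((c : K) ^ k) • plucker K I := by
    rw [torusAct_plucker, Finset.prod_const, I.2, Units.val_pow_eq_pow_val]
  rw [AlgHom.toLinearMap_apply, MvPolynomial.aeval_def, MvPolynomial.eval₂_eq, map_sum,
    Finset.smul_sum]
  refine Finset.sum_congr rfl fun m hm => ?_
  have hdeg : ∑ i ∈ m.support, m i = d := by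
    have := hf (MvPolynomial.mem_support_iff.1 hm)
    simpa [Finsupp.weight_apply, Finsupp.sum] using this
  rw [map_mul, map_prod, AlgEquiv.commutes, ← hdeg, Finset.mul_sum, ← Finset.prod_pow_eq_pow_sum,
    ← mul_smul_comm]
  simp only [map_pow, h, smul_pow, ← pow_mul, Finset.prod_smul]

/-- Graded components with different `d` lie in different eigenspaces of the scalar matrix `2`,
since `k > 0`. An eigenvector therefore has only one component. Directness of the grading is not
presupposed: independence of eigenspaces takes its place. -/
theorem mem_homogeneousPart_of_hasMultidegree [CharZero K] (hk : 0 < k) {f : coordRing K k n}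
    (hf : f ≠ 0) {w : Fin n → ℤ}
    (h : ∀ t : Fin n → Kˣ, torusAct k t f = character w t • f) :
    ∃ d : ℕ, f ∈ homogeneousPart K k n d ∧ ∑ j, w j = (k : ℤ) * d := by
  classical
  set c : Kˣ := Units.mk0 2 two_ne_zero with hc
  let T : Module.End K (coordRing K k n) := (torusAct k fun _ => c).toLinearMap
  have hT : T f = (2 : K) ^ (∑ j, w j) • f := by
    refine (h _).trans ?_
    rw [character_const, Units.val_zpow_eq_zpow_val]
    rfl
  obtain ⟨g, hg⟩ : ∃ g : MvPolynomial (KSubset k n) K,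
      MvPolynomial.aeval (plucker K (k := k) (n := n)) g = f := by
    have h1 : f.1 ∈ (MvPolynomial.aeval (R := K) (minor K (k := k) (n := n))).range := by
      rw [← Algebra.adjoin_range_eq_range_aeval]
      exact f.2
    obtain ⟨g, hg⟩ := h1
    refine ⟨g, Subtype.ext ?_⟩
    rw [← hg]
    have : (coordRing K k n).val.comp (MvPolynomial.aeval (plucker K (k := k) (n := n))) =
        MvPolynomial.aeval (minor K (k := k) (n := n)) := by
      apply MvPolynomial.algHom_ext
      intro I
      simp [plucker]
    exact DFunLike.congr_fun this g
  let F (i : ℕ) : coordRing K k n :=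
    MvPolynomial.aeval (plucker K (k := k) (n := n)) (MvPolynomial.homogeneousComponent i g)
  have hF (i : ℕ) : F i ∈ homogeneousPart K k n i :=
    ⟨_, MvPolynomial.homogeneousComponent_isHomogeneous i g, rfl⟩
  have hTF (i : ℕ) : T (F i) = (2 : K) ^ ((k : ℤ) * i) • F i := by
    refine (torusAct_const_homogeneousPart c (hF i)).trans ?_
    rw [← Nat.cast_mul, zpow_natCast]
    rfl
  have hsum : f = ∑ i ∈ Finset.range (g.totalDegree + 1), F i := by
    rw [← hg, ← map_sum, MvPolynomial.sum_homogeneousComponent]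
  set s := Finset.range (g.totalDegree + 1)
  have hsplit := Finset.sum_filter_add_sum_filter_not s (fun i : ℕ => (k : ℤ) * i = ∑ j, w j) F
  rw [← hsum] at hsplit
  have hdisj := Module.End.eigenspaces_iSupIndep T ((2 : K) ^ ∑ j, w j)
  rw [Submodule.disjoint_def] at hdisj
  -- The components of the wrong degrees sum to `f` minus an eigenvector for the same eigenvalue, so
  -- the sum lies both in that eigenspace and in the span of the others.
  have hzero : ∑ i ∈ s.filter fun i : ℕ => ¬ (k : ℤ) * i = ∑ j, w j, F i = 0 := by
    refine hdisj _ ?_ ?_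
    · rw [← eq_sub_iff_add_eq'] at hsplit
      rw [hsplit]
      refine sub_mem (Module.End.mem_eigenspace_iff.2 hT) (sum_mem fun (i : ℕ) hi => ?_)
      rw [Module.End.mem_eigenspace_iff, hTF, (Finset.mem_filter.1 hi).2]
    · refine sum_mem fun (i : ℕ) hi => ?_
      refine Submodule.mem_iSup_of_mem ((2 : K) ^ ((k : ℤ) * i)) (Submodule.mem_iSup_of_mem ?_ ?_)
      · exact fun e => (Finset.mem_filter.1 hi).2 (zpow_two_injective e)
      · exact Module.End.mem_eigenspace_iff.2 (hTF i)
  rw [hzero, add_zero] at hsplit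
  obtain ⟨d, hd⟩ : (s.filter fun i : ℕ => (k : ℤ) * i = ∑ j, w j).Nonempty := by
    by_contra hne
    rw [Finset.not_nonempty_iff_eq_empty] at hne
    rw [hne, Finset.sum_empty] at hsplit
    exact hf hsplit.symm
  have hd' := (Finset.mem_filter.1 hd).2
  refine ⟨d, ?_, hd'.symm⟩
  rw [← hsplit]
  refine sum_mem fun i hi => ?_
  have hi' := (Finset.mem_filter.1 hi).2
  have hk' : (k : ℤ) ≠ 0 := by exact_mod_cast hk.ne'
  have hid : i = d := by exact_mod_cast mul_left_cancel₀ hk' (hi'.trans hd'.symm)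
  exact hid ▸ hF i

end Degrees

/-! ### Positivity -/

section Positivity

variable {K : Type*} [Field K] {k n : ℕ}

variable (K k n) in
/-- The evaluation of the coordinate ring at the Vandermonde matrix of `0, …, n - 1`. -/
noncomputable def vandermondeEval : coordRing K k n →ₐ[K] K :=
  (MvPolynomial.aeval fun p : Fin k × Fin n => ((p.2 : ℕ) : K) ^ (p.1 : ℕ)).comp
    (coordRing K k n).val

/-- Columns are taken in increasing order, so the minor is a product of positive differences of
nodes. The value is recorded as a rational number because positivity has no meaning in `K`. -/
theorem vandermondeEval_plucker [CharZero K] (I : KSubset k n) :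
    ∃ r : ℚ, 0 < r ∧ vandermondeEval K k n (plucker K I) = r := by
  refine ⟨∏ i : Fin k, ∏ j ∈ Finset.Ioi i,
    (((I.1.orderEmbOfFin I.2 j : ℕ) : ℚ) - ((I.1.orderEmbOfFin I.2 i : ℕ) : ℚ)), ?_, ?_⟩
  · refine Finset.prod_pos fun i _ => Finset.prod_pos fun j hj => ?_
    rw [sub_pos, Nat.cast_lt]
    exact (I.1.orderEmbOfFin I.2).strictMono (Finset.mem_Ioi.1 hj)
  · have h : vandermondeEval K k n (plucker K I) =
        (Matrix.vandermonde fun j => ((I.1.orderEmbOfFin I.2 j : ℕ) : K)).transpose.det := by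
      simp only [vandermondeEval, plucker, minor, AlgHom.comp_apply, Subalgebra.coe_val]
      rw [AlgHom.map_det]
      congr 1
      ext i j
      simp [genericMatrix, Matrix.vandermonde]
    rw [h, Matrix.det_transpose, Matrix.det_vandermonde]
    push_cast
    rfl

/-- A quotient of two functions with positive rational values at the Vandermonde matrix. -/
def IsVandermondePositive (z : FunctionField K k n) : Prop :=
  ∃ (a b : coordRing K k n) (r s : ℚ), 0 < r ∧ 0 < s ∧
    vandermondeEval K k n a = r ∧ vandermondeEval K k n b = s ∧
    z = algebraMap (coordRing K k n) (FunctionField K k n) a /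
      algebraMap (coordRing K k n) (FunctionField K k n) b

theorem ne_zero_of_vandermondeEval [CharZero K] {a : coordRing K k n} {r : ℚ} (hr : 0 < r)
    (h : vandermondeEval K k n a = r) : a ≠ 0 := by
  rintro rfl
  rw [map_zero, eq_comm, Rat.cast_eq_zero] at h
  exact hr.ne' h

/-- This is the purpose of positivity: it passes through products, sums and quotients, hence through
mutation, whereas being nonzero does not pass through sums. -/
theorem IsVandermondePositive.ne_zero [CharZero K] {z : FunctionField K k n}
    (h : IsVandermondePositive z) : z ≠ 0 := by
  obtain ⟨a, b, r, s, hr, hs, ha, hb, rfl⟩ := h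
  exact div_ne_zero (algebraMap_ne_zero (ne_zero_of_vandermondeEval hr ha))
    (algebraMap_ne_zero (ne_zero_of_vandermondeEval hs hb))

theorem isVandermondePositive_plucker [CharZero K] (I : KSubset k n) :
    IsVandermondePositive (algebraMap (coordRing K k n) (FunctionField K k n) (plucker K I)) := by
  obtain ⟨r, hr, h⟩ := vandermondeEval_plucker (K := K) I
  exact ⟨plucker K I, 1, r, 1, hr, one_pos, h, by simp, by simp⟩

theorem IsVandermondePositive.one : IsVandermondePositive (1 : FunctionField K k n) :=
  ⟨1, 1, 1, 1, one_pos, one_pos, by simp, by simp, by simp⟩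

variable [CharZero K]

theorem IsVandermondePositive.mul {y z : FunctionField K k n}
    (hy : IsVandermondePositive y) (hz : IsVandermondePositive z) :
    IsVandermondePositive (y * z) := by
  obtain ⟨a, b, r, s, hr, hs, ha, hb, rfl⟩ := hy
  obtain ⟨a', b', r', s', hr', hs', ha', hb', rfl⟩ := hz
  refine ⟨a * a', b * b', r * r', s * s', mul_pos hr hr', mul_pos hs hs', ?_, ?_, ?_⟩
  · rw [map_mul, ha, ha', Rat.cast_mul]
  · rw [map_mul, hb, hb', Rat.cast_mul]
  · rw [map_mul, map_mul, div_mul_div_comm]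

theorem IsVandermondePositive.add {y z : FunctionField K k n}
    (hy : IsVandermondePositive y) (hz : IsVandermondePositive z) :
    IsVandermondePositive (y + z) := by
  obtain ⟨a, b, r, s, hr, hs, ha, hb, rfl⟩ := hy
  obtain ⟨a', b', r', s', hr', hs', ha', hb', rfl⟩ := hz
  refine ⟨a * b' + b * a', b * b', r * s' + s * r', s * s', by positivity, by positivity, ?_, ?_, ?_⟩
  · rw [map_add, map_mul, map_mul, ha, ha', hb, hb']
    push_cast
    rfl
  · rw [map_mul, hb, hb', Rat.cast_mul]
  · exact map_div_add_map_div _ (algebraMap_ne_zero (ne_zero_of_vandermondeEval hs hb))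
      (algebraMap_ne_zero (ne_zero_of_vandermondeEval hs' hb'))

theorem IsVandermondePositive.div {y z : FunctionField K k n}
    (hy : IsVandermondePositive y) (hz : IsVandermondePositive z) :
    IsVandermondePositive (y / z) := by
  rw [div_eq_mul_inv]
  refine hy.mul ?_
  obtain ⟨a, b, r, s, hr, hs, ha, hb, rfl⟩ := hz
  exact ⟨b, a, s, r, hs, hr, hb, ha, by rw [inv_div]⟩

theorem IsVandermondePositive.pow {z : FunctionField K k n}
    (hz : IsVandermondePositive z) (r : ℕ) : IsVandermondePositive (z ^ r) := by
  induction r with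
  | zero => simpa using IsVandermondePositive.one
  | succ r ih => rw [pow_succ]; exact ih.mul hz

theorem IsVandermondePositive.prod {ι : Type*} (s : Finset ι)
    {z : ι → FunctionField K k n} (h : ∀ i ∈ s, IsVandermondePositive (z i)) :
    IsVandermondePositive (∏ i ∈ s, z i) :=
  Finset.prod_induction _ _ (fun _ _ => IsVandermondePositive.mul) .one h

end Positivity

/-! ### Balanced weights and quiver mutation -/

section Balance

variable {M N A : Type*} [AddCommGroup A]

/-- At every mutable vertex the weights of the arrows in and of the arrows out have equal sums. -/
def IsBalanced [Fintype M] [Fintype N] (arr : M ⊕ N → M ⊕ N → ℕ) (w : M ⊕ N → A) : Prop :=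
  ∀ m : M, ∑ v, arr v (Sum.inl m) • w v = ∑ v, arr (Sum.inl m) v • w v

/-- Balance depends only on the signed arrow counts, so cancelling 2-cycles cannot affect it. -/
theorem isBalanced_iff [Fintype M] [Fintype N] {arr : M ⊕ N → M ⊕ N → ℕ} {w : M ⊕ N → A} :
    IsBalanced arr w ↔
      ∀ m : M, ∑ v, ((arr v (Sum.inl m) : ℤ) - (arr (Sum.inl m) v : ℤ)) • w v = 0 := by
  simp only [IsBalanced, sub_smul, natCast_zsmul, Finset.sum_sub_distrib, sub_eq_zero]

/-- The two truncated differences are the positive and negative parts of one integer, so truncation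
disappears from the signed count. -/
theorem mutateArr_sub [DecidableEq M] [DecidableEq N] (arr : M ⊕ N → M ⊕ N → ℕ) (m i j : M ⊕ N) :
    (mutateArr arr m i j : ℤ) - mutateArr arr m j i =
      if i = m ∨ j = m then (arr j i : ℤ) - arr i j
      else (arr i j - arr j i) + (arr i m * arr m j - arr j m * arr m i) := by
  unfold mutateArr
  by_cases h : i = m ∨ j = m
  · rw [if_pos h, if_pos h.symm, if_pos h]
  · rw [if_neg h, if_neg (fun h' => h h'.symm), if_neg h]
    have h1 : ((arr i m * arr m j : ℕ) : ℤ) = arr i m * arr m j := by push_cast; rfl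
    have h2 : ((arr j m * arr m i : ℕ) : ℤ) = arr j m * arr m i := by push_cast; rfl
    omega

theorem mutateArr_self [DecidableEq M] [DecidableEq N] {arr : M ⊕ N → M ⊕ N → ℕ}
    (h : ∀ v, arr v v = 0) (m v : M ⊕ N) :
    mutateArr arr m v v = 0 := by
  simp [mutateArr, h]

/-- At `m` all signs flip, and the changed weight has coefficient zero as there are no loops. At
another vertex `j`, with `b` the signed number of arrows from `m` to `j`, the added paths contribute
`b • W` by balance at `m`. Reversing the arrows at `m` turns `b • w m` into `-b • (W - w m)`, which
offsets this exactly. -/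
theorem IsBalanced.mutate [Fintype M] [Fintype N] [DecidableEq M] [DecidableEq N]
    {arr : M ⊕ N → M ⊕ N → ℕ} {w : M ⊕ N → A} (hloop : ∀ v, arr v v = 0)
    (h : IsBalanced arr w) (m : M) :
    IsBalanced (mutateArr arr (Sum.inl m))
      (Function.update w (Sum.inl m) (∑ v, arr v (Sum.inl m) • w v - w (Sum.inl m))) := by
  have hm := h m
  rw [isBalanced_iff] at h ⊢
  intro j
  simp only [mutateArr_sub]
  by_cases hj : j = m
  · subst hj
    rw [← neg_eq_zero, ← Finset.sum_neg_distrib, ← h j]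
    refine Finset.sum_congr rfl fun v _ => ?_
    rw [if_pos (Or.inr rfl), ← neg_smul, neg_sub]
    by_cases hv : v = Sum.inl j
    · subst hv
      simp
    · rw [Function.update_of_ne hv]
  · have hj' : (Sum.inl j : M ⊕ N) ≠ Sum.inl m := fun e => hj (Sum.inl_injective e)
    set μ : M ⊕ N := Sum.inl m
    set ν : M ⊕ N := Sum.inl j
    set W := ∑ v, arr v μ • w v
    -- Each summand is split into the old one, the paths through `μ`, and a correction by `W`
    -- supported at `v = μ`.
    have key (v : M ⊕ N) : (if v = μ ∨ ν = μ then (arr ν v : ℤ) - arr v ν else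
        (arr v ν - arr ν v) + (arr v μ * arr μ ν - arr ν μ * arr μ v)) •
          Function.update w μ (W - w μ) v =
        ((arr v ν : ℤ) - arr ν v) • w v + ((arr μ ν : ℤ) • (arr v μ • w v) -
          (arr ν μ : ℤ) • (arr μ v • w v)) +
          if v = μ then ((arr ν μ : ℤ) - arr μ ν) • W else 0 := by
      by_cases hv : v = μ
      · subst hv
        simp only [true_or, if_true, Function.update_self, hloop]
        module
      · simp only [hv, hj', or_self, if_false, Function.update_of_ne hv]
        module
    rw [Finset.sum_congr rfl fun v _ => key v, Finset.sum_add_distrib, Finset.sum_add_distrib,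
      h j, Finset.sum_sub_distrib, ← Finset.smul_sum, ← Finset.smul_sum, ← hm,
      Finset.sum_ite_eq' Finset.univ μ, if_pos (Finset.mem_univ _)]
    module

end Balance

/-! ### The initial quiver -/

section InitialQuiver

variable {k n : ℕ}

theorem vertexAt_eq_inl_iff (hkn : k < n) (p : ℕ × ℕ) (u : MutableVertex k n) :
    vertexAt hkn p = Sum.inl u ↔ p = gridPoint u := by
  obtain ⟨i, g⟩ := p
  obtain ⟨⟨a, ha⟩, ⟨b, hb⟩⟩ := u
  unfold vertexAt gridPoint
  split_ifs with h
  · simp only [Sum.inl.injEq, Prod.mk.injEq, Fin.mk.injEq] at h ⊢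
    omega
  all_goals
    simp only [Prod.mk.injEq, false_iff] at h ⊢
    omega

theorem count_pair {α : Type*} [DecidableEq α] (a b c : α) :
    ({a, b} : Multiset α).count c = (if a = c then 1 else 0) + if b = c then 1 else 0 := by
  simp only [Multiset.insert_eq_cons, Multiset.count_cons, Multiset.count_singleton, eq_comm]
  exact add_comm _ _

/-- The parity of `i + g` changes between grid neighbours, so the direction that is outgoing at one
end is incoming at the other. Hence `initialArr`, which reads arrows between mutable vertices off
their source, also agrees with `inNbrs` at the target. -/
theorem count_outNbrs_inl (hkn : k < n) (u v : MutableVertex k n) :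
    (outNbrs hkn u).count (Sum.inl v) = (inNbrs hkn v).count (Sum.inl u) := by
  have e1 (u : MutableVertex k n) : gridPoint u = (u.1.val + 1, u.2.val + 1) := rfl
  unfold outNbrs inNbrs verticalNbrs horizontalNbrs
  simp only [apply_ite (Multiset.count _), count_pair, vertexAt_eq_inl_iff]
  simp only [e1, Prod.mk.injEq, Nat.even_iff]
  split_ifs <;> omega

theorem initialArr_self (hkn : k < n) (v : Vertex k n) : initialArr hkn v v = 0 := by
  rcases v with u | j
  · have e1 : gridPoint u = (u.1.val + 1, u.2.val + 1) := rfl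
    simp only [initialArr, outNbrs, verticalNbrs, horizontalNbrs, apply_ite (Multiset.count _),
      count_pair, vertexAt_eq_inl_iff]
    simp only [e1, Prod.mk.injEq]
    split_ifs <;> omega
  · rfl

theorem sum_count_smul {α A : Type*} [Fintype α] [DecidableEq α] [AddCommMonoid A]
    (s : Multiset α) (w : α → A) : ∑ v, s.count v • w v = (s.map w).sum := by
  rw [Finset.sum_multiset_map_count]
  refine (Finset.sum_subset (Finset.subset_univ _) fun v _ hv => ?_).symm
  rw [Multiset.count_eq_zero.2 (by simpa using hv), zero_smul]

/-- The indicator vector of the residue class of `x` modulo `n`. -/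
def residueWeight (n : ℕ) (x : ℤ) (c : Fin n) : ℤ := if ((c : ℤ) - x) % (n : ℤ) = 0 then 1 else 0

/-- The sum of the indicator vectors of the residue classes of `s, …, s + l - 1`. -/
def intervalWeight (n : ℕ) (s : ℤ) (l : ℕ) : Fin n → ℤ :=
  ∑ r ∈ Finset.range l, residueWeight n (s + r)

theorem intervalWeight_zero (s : ℤ) : intervalWeight n s 0 = 0 := by
  simp [intervalWeight]

/-- Residues are counted with multiplicity, so additivity needs no bound on the lengths and no
disjointness. -/
theorem intervalWeight_add (s : ℤ) (l m : ℕ) :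
    intervalWeight n s (l + m) = intervalWeight n s l + intervalWeight n (s + l) m := by
  simp only [intervalWeight, Finset.sum_range_add, Nat.cast_add, add_assoc]

theorem intervalWeight_one (s : ℤ) : intervalWeight n s 1 = residueWeight n s := by
  simp [intervalWeight]

theorem intervalWeight_congr {s s' : ℤ} (h : s % n = s' % n) (l : ℕ) :
    intervalWeight n s l = intervalWeight n s' l := by
  unfold intervalWeight residueWeight
  refine Finset.sum_congr rfl fun r _ => funext fun c => ?_
  have : ((c : ℤ) - (s + r)) % n = ((c : ℤ) - (s' + r)) % n :=
    Int.ModEq.sub_left _ (Int.ModEq.add_right _ h)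
  rw [this]

theorem indicatorWeight_cycInterval (s : ℤ) (l : ℕ) (hl : l ≤ n) :
    indicatorWeight (cycInterval n s l) = intervalWeight n s l := by
  induction l with
  | zero =>
    funext c
    have hn : (0 : ℤ) < n := by have := c.2; omega
    have := Int.emod_nonneg ((c : ℤ) - s) hn.ne'
    simp [indicatorWeight, intervalWeight, cycInterval, this]
  | succ l ih =>
    rw [intervalWeight_add, intervalWeight_one, ← ih (by omega)]
    funext c
    have hn : (0 : ℤ) < n := by have := c.2; omega
    have h1 := Int.emod_nonneg ((c : ℤ) - s) hn.ne'
    -- Lengthening the interval adds exactly the column at distance `l` from `s`; this uses `l < n`.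
    have h2 : ((c : ℤ) - (s + l)) % n = 0 ↔ ((c : ℤ) - s) % n = l := by
      have e : ((l : ℤ)) % n = l := Int.emod_eq_of_lt (by omega) (by omega)
      constructor
      · intro h
        rw [← e]
        refine Int.emod_emod_of_dvd _ dvd_rfl ▸ Int.emod_emod_of_dvd ((c : ℤ) - s) dvd_rfl ▸ ?_
        rw [Int.emod_eq_emod_iff_emod_sub_eq_zero]
        simpa [sub_sub] using h
      · intro h
        rw [← sub_sub, ← Int.emod_eq_emod_iff_emod_sub_eq_zero, e, h]
    simp only [indicatorWeight, cycInterval, Finset.mem_filter, Finset.mem_univ, true_and,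
      Pi.add_apply, residueWeight, h2, Nat.cast_add, Nat.cast_one]
    split_ifs <;> omega

/-- The weight of the grid point `(i, g)`. -/
def gridWeight (k n : ℕ) (p : ℕ × ℕ) : Fin n → ℤ :=
  intervalWeight n (offset p) p.1 + intervalWeight n (offset p + p.1 + p.2) (k - p.1)

theorem indicatorWeight_label_inl (hkn : k < n) (u : MutableVertex k n) :
    indicatorWeight (label hkn (Sum.inl u)).1 =
      gridWeight k n (gridPoint u) := by
  have h1 := u.1.isLt
  have h2 := u.2.isLt
  have e1 : (gridPoint u).1 = u.1.val + 1 := rfl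
  have e2 : (gridPoint u).2 = u.2.val + 1 := rfl
  rw [gridWeight, ← indicatorWeight_cycInterval _ _ (by omega),
    ← indicatorWeight_cycInterval _ _ (by omega)]
  funext c
  have hd : c ∈ cycInterval n (offset (gridPoint u)) (gridPoint u).1 →
      c ∉ cycInterval n (offset (gridPoint u) + (gridPoint u).1 + (gridPoint u).2)
        (k - (gridPoint u).1) :=
    fun hc => Finset.disjoint_left.1 (disjoint_cycInterval n _ _ _ _ (by omega)) hc
  simp only [indicatorWeight, label, Finset.mem_union, Pi.add_apply]
  by_cases h : c ∈ cycInterval n (offset (gridPoint u)) (gridPoint u).1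
  · simp [h, hd h]
  · simp [h]

theorem indicatorWeight_label_inr (hkn : k < n) (j : Fin n) :
    indicatorWeight (label hkn (Sum.inr j)).1 = intervalWeight n j k :=
  indicatorWeight_cycInterval _ _ hkn.le

/-- On the boundary one of the two intervals is empty (`i = 0` or `i = k`), or they are adjacent:
for `g = 0` the second follows the first, and for `g = n - k` the first follows the second modulo
`n`. -/
theorem indicatorWeight_label_vertexAt (hkn : k < n) (p : ℕ × ℕ) (h1 : p.1 ≤ k) (h2 : p.2 ≤ n - k) :
    indicatorWeight (label hkn (vertexAt hkn p)).1 = gridWeight k n p := by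
  by_cases h : (0 < p.1 ∧ p.1 < k) ∧ (0 < p.2 ∧ p.2 < n - k)
  · have e : vertexAt hkn p = Sum.inl (⟨p.1 - 1, by omega⟩, ⟨p.2 - 1, by omega⟩) := by
      rw [vertexAt, dif_pos h]
    have e' := (vertexAt_eq_inl_iff hkn p _).1 e
    rw [e, indicatorWeight_label_inl, ← e']
  · have hn : (n : ℤ) ≠ 0 := by omega
    rw [vertexAt, dif_neg h, indicatorWeight_label_inr]
    simp only [Int.toNat_of_nonneg (Int.emod_nonneg _ hn)]
    rw [intervalWeight_congr (Int.emod_emod_of_dvd _ dvd_rfl), gridWeight]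
    obtain ⟨i, g⟩ := p
    simp only at h h1 h2 ⊢
    split_ifs with hc
    · rcases hc with rfl | rfl
      · simp [intervalWeight_zero]
      · obtain ⟨r, rfl⟩ := Nat.exists_eq_add_of_le h1
        rw [add_tsub_cancel_left, add_comm i r, intervalWeight_add, add_comm]
        congr 1
        -- The second interval ends at `offset + n`, which is the start of the first one modulo `n`.
        refine intervalWeight_congr ?_ _
        rw [← Int.add_emod_right (offset _)]
        congr 1
        omega
    · obtain rfl | rfl : i = k ∨ g = 0 := by omega
      · simp [intervalWeight_zero]
      · rw [Nat.cast_zero, add_zero, ← intervalWeight_add, Nat.add_sub_cancel' h1]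

/-- The two intervals end at the same place, so extending either of them adds the same residue. -/
theorem intervalWeight_exchange {s s' : ℤ} {l l' : ℕ} (h : s + l = s' + l') :
    intervalWeight n s (l + 1) + intervalWeight n s' l' =
      intervalWeight n s l + intervalWeight n s' (l' + 1) := by
  rw [intervalWeight_add, intervalWeight_add, h]
  abel

/-- This is the weight identity behind a short Plücker relation. It splits into one endpoint
exchange for the first intervals and one for the second intervals. -/
theorem gridWeight_cross (p : ℕ × ℕ) (h1 : 0 < p.1) (h1' : p.1 < k) (h2 : 0 < p.2) :
    gridWeight k n (p.1 + 1, p.2) + gridWeight k n (p.1 - 1, p.2) =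
      gridWeight k n (p.1, p.2 + 1) + gridWeight k n (p.1, p.2 - 1) := by
  obtain ⟨i, g⟩ := p
  obtain ⟨i, rfl⟩ := Nat.exists_eq_add_of_lt h1
  obtain ⟨g, rfl⟩ := Nat.exists_eq_add_of_lt h2
  obtain ⟨r, rfl⟩ := Nat.exists_eq_add_of_lt h1'
  simp only [zero_add, Nat.add_sub_cancel, gridWeight]
  have s1 : i + 1 + r + 1 - (i + 1 + 1) = r := by omega
  have s2 : i + 1 + r + 1 - (i + 1) = r + 1 := by omega
  have s3 : i + 1 + r + 1 - i = r + 1 + 1 := by omega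
  -- Among the four neighbours `i + g` takes two values that differ by `2`, so the offsets are `x`
  -- and `x + 1` whatever the parity.
  obtain ⟨x, hx⟩ : ∃ x, offset (i + 1 + 1, g + 1) = x := ⟨_, rfl⟩
  have o2 : offset (i, g + 1) = x + 1 := by rw [← hx]; simp only [offset]; omega
  have o3 : offset (i + 1, g + 1 + 1) = x := by rw [← hx]; simp only [offset]; omega
  have o4 : offset (i + 1, g) = x + 1 := by rw [← hx]; simp only [offset]; omega
  rw [s1, s2, s3, hx, o2, o3, o4]
  have y1 : x + ((i + 1 + 1 : ℕ) : ℤ) + ((g + 1 : ℕ) : ℤ) = x + i + g + 3 := by push_cast; ring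
  have y2 : x + 1 + (i : ℤ) + ((g + 1 : ℕ) : ℤ) = x + i + g + 2 := by push_cast; ring
  have y3 : x + ((i + 1 : ℕ) : ℤ) + ((g + 1 + 1 : ℕ) : ℤ) = x + i + g + 3 := by push_cast; ring
  have y4 : x + 1 + ((i + 1 : ℕ) : ℤ) + (g : ℤ) = x + i + g + 2 := by push_cast; ring
  rw [y1, y2, y3, y4, add_add_add_comm, add_add_add_comm (intervalWeight n x (i + 1)),
    intervalWeight_exchange (s := x) (s' := x + 1) (l := i + 1) (l' := i) (by push_cast; ring),
    add_comm (intervalWeight n _ r),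
    intervalWeight_exchange (s := x + i + g + 2) (s' := x + i + g + 3) (l := r + 1) (l' := r)
      (by push_cast; ring),
    add_comm (intervalWeight n (x + i + g + 2) (r + 1))]

theorem isBalanced_initialArr (hkn : k < n) :
    IsBalanced (initialArr hkn) fun v => indicatorWeight (label hkn v).1 := by
  intro m
  set w : Vertex k n → Fin n → ℤ := fun v => indicatorWeight (label hkn v).1
  have hin (v : Vertex k n) : initialArr hkn v (Sum.inl m) = (inNbrs hkn m).count v := by
    rcases v with u | j
    · exact count_outNbrs_inl hkn u m
    · rfl
  have hout (v : Vertex k n) : initialArr hkn (Sum.inl m) v = (outNbrs hkn m).count v := rfl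
  simp only [hin, hout, sum_count_smul]
  have e1 : (gridPoint m).1 = m.1.val + 1 := rfl
  have e2 : (gridPoint m).2 = m.2.val + 1 := rfl
  have l1 := m.1.isLt
  have l2 := m.2.isLt
  have hv : ((verticalNbrs hkn (gridPoint m)).map w).sum =
      ((horizontalNbrs hkn (gridPoint m)).map w).sum := by
    simp only [verticalNbrs, horizontalNbrs, Multiset.insert_eq_cons, Multiset.map_cons,
      Multiset.map_singleton, Multiset.sum_cons, Multiset.sum_singleton]
    have hw (p : ℕ × ℕ) (h1 : p.1 ≤ k) (h2 : p.2 ≤ n - k) :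
        w (vertexAt hkn p) = gridWeight k n p := indicatorWeight_label_vertexAt hkn p h1 h2
    rw [hw _ (by simp only; omega) (by simp only; omega),
      hw _ (by simp only; omega) (by simp only; omega),
      hw _ (by simp only; omega) (by simp only; omega),
      hw _ (by simp only; omega) (by simp only; omega)]
    exact gridWeight_cross _ (by omega) (by omega) (by omega)
  unfold inNbrs outNbrs
  split_ifs
  · exact hv
  · exact hv.symm

end InitialQuiver

/-! ### Seeds -/

section MutateVar

variable {M N F : Type*} [Fintype M] [Fintype N] [DecidableEq M] [DecidableEq N] [Field F]

theorem Seed.mutate_var_self (S : Seed M N F) (m : M) :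
    (S.mutate m).var (Sum.inl m) =
      (∏ v, S.var v ^ S.arr v (Sum.inl m) + ∏ v, S.var v ^ S.arr (Sum.inl m) v) /
        S.var (Sum.inl m) :=
  Function.update_self ..

theorem Seed.mutate_var_of_ne (S : Seed M N F) {m : M} {v : M ⊕ N} (h : v ≠ Sum.inl m) :
    (S.mutate m).var v = S.var v :=
  Function.update_of_ne h ..

end MutateVar

section GradedSeeds

variable {K : Type*} [Field K] {k n : ℕ}

/-- A seed with a loop-free quiver and positive homogeneous variables of balanced multidegrees. -/
structure IsGradedSeed (S : Seed (MutableVertex k n) (Fin n) (FunctionField K k n))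
    (w : Vertex k n → Fin n → ℤ) (d : Vertex k n → ℤ) : Prop where
  arr_self : ∀ v, S.arr v v = 0
  balanced : IsBalanced S.arr w
  sum_eq : ∀ v, ∑ j, w v j = (k : ℤ) * d v
  positive : ∀ v, IsVandermondePositive (S.var v)
  multidegree : ∀ v, HasMultidegree (w v) (S.var v)
  homogeneous : ∀ v, IsHomogeneousOfDegree (d v) (S.var v)

theorem isGradedSeed_initialSeed [CharZero K] (hkn : k < n) :
    IsGradedSeed (initialSeed K hkn) (fun v => indicatorWeight (label hkn v).1) fun _ => 1 where
  arr_self := initialArr_self hkn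
  balanced := isBalanced_initialArr hkn
  sum_eq v := by rw [sum_indicatorWeight, (label hkn v).2, mul_one]
  positive v := isVandermondePositive_plucker _
  multidegree v := hasMultidegree_plucker _
  homogeneous v := by
    exact_mod_cast isHomogeneousOfDegree_algebraMap (plucker_mem_homogeneousPart (label hkn v))

/-- Summing the coordinates of the balanced multidegrees gives `k` times the balance of degrees, and
`k` cancels. -/
theorem IsGradedSeed.degree_balanced (hk : 0 < k)
    {S : Seed (MutableVertex k n) (Fin n) (FunctionField K k n)} {w : Vertex k n → Fin n → ℤ}
    {d : Vertex k n → ℤ} (h : IsGradedSeed S w d) : IsBalanced S.arr d := by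
  intro m
  have hk' : (k : ℤ) ≠ 0 := by exact_mod_cast hk.ne'
  refine mul_left_cancel₀ hk' ?_
  have key (a : Vertex k n → ℕ) : (k : ℤ) * ∑ v, a v • d v = ∑ j, (∑ v, a v • w v) j := by
    simp only [Finset.mul_sum, Finset.sum_apply, Pi.smul_apply]
    rw [Finset.sum_comm]
    refine Finset.sum_congr rfl fun v _ => ?_
    rw [← Finset.smul_sum, h.sum_eq, mul_smul_comm]
  rw [key, key, h.balanced m]

theorem IsGradedSeed.mutate [CharZero K] (hk : 0 < k)
    {S : Seed (MutableVertex k n) (Fin n) (FunctionField K k n)} {w : Vertex k n → Fin n → ℤ}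
    {d : Vertex k n → ℤ} (h : IsGradedSeed S w d) (m : MutableVertex k n) :
    IsGradedSeed (S.mutate m)
      (Function.update w (Sum.inl m)
        (∑ v, S.arr v (Sum.inl m) • w v - w (Sum.inl m)))
      (Function.update d (Sum.inl m)
        (∑ v, S.arr v (Sum.inl m) • d v - d (Sum.inl m))) where
  arr_self := mutateArr_self h.arr_self _
  balanced := h.balanced.mutate h.arr_self m
  sum_eq v := by
    by_cases hv : v = Sum.inl m
    · subst hv
      simp only [Function.update_self, Pi.sub_apply, Finset.sum_sub_distrib, mul_sub, h.sum_eq,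
        Finset.sum_apply, Pi.smul_apply, Finset.mul_sum]
      rw [Finset.sum_comm]
      simp only [← Finset.smul_sum, h.sum_eq, mul_smul_comm]
    · rw [Function.update_of_ne hv, Function.update_of_ne hv, h.sum_eq]
  positive v := by
    by_cases hv : v = Sum.inl m
    · subst hv
      rw [Seed.mutate_var_self]
      exact ((IsVandermondePositive.prod _ fun v _ => (h.positive v).pow _).add
        (.prod _ fun v _ => (h.positive v).pow _)).div (h.positive _)
    · rw [Seed.mutate_var_of_ne S hv]
      exact h.positive v
  multidegree v := by
    by_cases hv : v = Sum.inl m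
    · subst hv
      rw [Seed.mutate_var_self, Function.update_self]
      refine HasMultidegree.div (.add (.prod _ fun v _ => (h.multidegree v).pow _) ?_)
        (h.multidegree _)
      -- Balance at `m` gives the outgoing monomial the weight of the incoming one, so that the sum
      -- is an eigenfunction.
      rw [h.balanced m]
      exact .prod _ fun v _ => (h.multidegree v).pow _
    · rw [Seed.mutate_var_of_ne S hv, Function.update_of_ne hv]
      exact h.multidegree v
  homogeneous v := by
    by_cases hv : v = Sum.inl m
    · subst hv
      rw [Seed.mutate_var_self, Function.update_self]
      refine IsHomogeneousOfDegree.div (h.positive _).ne_zero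
        (.add (.prod _ fun v _ => (h.homogeneous v).pow _) ?_) (h.homogeneous _)
      rw [h.degree_balanced hk m]
      exact .prod _ fun v _ => (h.homogeneous v).pow _
    · rw [Seed.mutate_var_of_ne S hv, Function.update_of_ne hv]
      exact h.homogeneous v

theorem exists_isGradedSeed [CharZero K] (hk : 0 < k) (hkn : k < n)
    {S : Seed (MutableVertex k n) (Fin n) (FunctionField K k n)} (hS : S ∈ seeds K hkn) :
    ∃ w d, IsGradedSeed S w d := by
  have hS' : (initialSeed K hkn).MutatesTo S := hS
  induction hS' with
  | refl => exact ⟨_, _, isGradedSeed_initialSeed hkn⟩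
  | step S' m hm ih =>
    obtain ⟨w, d, h⟩ := ih hm
    exact ⟨_, _, h.mutate hk m⟩

end GradedSeeds

end GrCluster

theorem lemma2p3 {K : Type*} [Field K] [CharZero K] {k n : ℕ} (hk : 0 < k) (hkn : k < n) :
    -- every cluster variable is a homogeneous eigenfunction in the field of fractions
    (∀ z ∈ GrCluster.clusterVariables K hkn, z ≠ 0 ∧
      ∃ (e : ℤ) (w : Fin n → ℤ), GrCluster.IsHomogeneousOfDegree e z ∧
        GrCluster.HasMultidegree w z ∧ ∑ j, w j = (k : ℤ) * e) ∧
    -- as an element of the coordinate ring it is homogeneous and an eigenfunction there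
    (∀ f : GrCluster.coordRing K k n,
      algebraMap (GrCluster.coordRing K k n) (GrCluster.FunctionField K k n) f ∈
        GrCluster.clusterVariables K hkn →
      ∃ (d : ℕ) (w : Fin n → ℤ), f ∈ GrCluster.homogeneousPart K k n d ∧
        (∀ t : Fin n → Kˣ, GrCluster.torusAct k t f = GrCluster.character w t • f) ∧
        ∑ j, w j = (k : ℤ) * (d : ℤ)) ∧
    -- the multidegrees are well defined and balanced at every mutable vertex of every seed
    (∀ S ∈ GrCluster.seeds K hkn, ∃ w : GrCluster.Vertex k n → Fin n → ℤ,
      (∀ v u, GrCluster.HasMultidegree u (S.var v) ↔ u = w v) ∧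
      ∀ m : GrCluster.MutableVertex k n,
        ∑ v, S.arr v (Sum.inl m) • w v = ∑ v, S.arr (Sum.inl m) v • w v) := by
  refine ⟨?_, ?_, ?_⟩
  · rintro _ ⟨S, hS, v, rfl⟩
    obtain ⟨w, d, h⟩ := GrCluster.exists_isGradedSeed hk hkn hS
    exact ⟨(h.positive v).ne_zero, d v, w v, h.homogeneous v, h.multidegree v, h.sum_eq v⟩
  · rintro f ⟨S, hS, v, hv⟩
    obtain ⟨w, d, h⟩ := GrCluster.exists_isGradedSeed hk hkn hS
    have h0 := (h.positive v).ne_zero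
    have hw := h.multidegree v
    rw [hv] at h0 hw
    rw [GrCluster.hasMultidegree_algebraMap_iff] at hw
    have hf : f ≠ 0 := by
      rintro rfl
      exact h0 (map_zero _)
    -- The degree in the ring is recovered from the multidegree alone, not from the degree of `f` as
    -- a fraction.
    obtain ⟨e, he, hsum⟩ := GrCluster.mem_homogeneousPart_of_hasMultidegree hk hf hw
    exact ⟨e, w v, he, hw, hsum⟩
  · intro S hS
    obtain ⟨w, d, h⟩ := GrCluster.exists_isGradedSeed hk hkn hS
    refine ⟨w, fun v u => ⟨fun hu => hu.eq (h.positive v).ne_zero (h.multidegree v), ?_⟩,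
      h.balanced⟩
    rintro rfl
    exact h.multidegree v
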